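/- Let $K(x)=\frac{x^\perp}{2\pi|x|^2}$, $x^\perp=(-x_2,x_1)$, be the Biot–Savart kernel on $\mathbb{R}^2$, and let $Q_0\in(1,2)$, $Q_1\in(2,\infty)$. Let $\omega:\mathbb{R}^2\times[0,\infty)\to\mathbb{R}$ and $v:\mathbb{R}^2\times[0,\infty)\to\mathbb{R}^2$ be $C^\infty$ (up to and including $t=0$) and form a solution of the planar Euler equations in vorticity form with external force $Z:\mathbb{R}^2\times[0,\infty)\to\mathbb{R}$, $$\begin{cases}\partial_t\omega(x,t)=-(v(x,t),\partial_x)\,\omega(x,t)+Z(x,t), & x\in\mathbb{R}^2,\ t\in[0,\infty),\\ \omega(x,t)=\operatorname{curl}_x v(x,t)=\partial_1v_2-\partial_2v_1,\qquad \operatorname{div}_x v(x,t)=0,\\ \omega(x,0)=\omega_0(x)\in L^{Q_0}(\mathbb{R}^2)\cap L^{Q_1}(\mathbb{R}^2),\end{cases}$$ where $v(x,t)=(K*\omega(\cdot,t))(x)$, $\omega\in L^\infty_{loc}([0,\infty);L^{Q_0}(\mathbb{R}^2)\cap L^{Q_1}(\mathbb{R}^2))$ and $Z\in L^1_{loc}([0,\infty);L^{Q_0}(\mathbb{R}^2)\cap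 L^{Q_1}(\mathbb{R}^2))$. Then for every $Q\in[1,\infty]$ and every $t\ge0$ $$\|\omega(\cdot,t)\|_{L^Q(\mathbb{R}^2)}\le\|\omega_0\|_{L^Q(\mathbb{R}^2)}+\int_0^t\|Z(\cdot,s)\|_{L^Q(\mathbb{R}^2)}\,ds,$$ as an inequality in $[0,\infty]$; in particular, the left side is finite whenever the right side is. -/

import Mathlib

namespace PlanarEuler

/-- The plane `ℝ²` with its Euclidean norm; `volume` on it is Lebesgue measure. -/
abbrev Plane : Type := EuclideanSpace ℝ (Fin 2)

/-- `x^⊥ = (-x₂, x₁)`. -/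
noncomputable def perp (x : Plane) : Plane := !₂[-x 1, x 0]

/-- The Biot-Savart kernel `K(x) = x^⊥ / (2π|x|²)` (its value at the origin plays no role). -/
noncomputable def biotSavartKernel (x : Plane) : Plane := (2 * Real.pi * ‖x‖ ^ 2)⁻¹ • perp x

/-- The convolution `(K * f)(x) = ∫ K(x - y) f(y) dy`. -/
noncomputable def biotSavart (f : Plane → ℝ) (x : Plane) : Plane :=
  ∫ y, f y • biotSavartKernel (x - y)

/-- `curl u = ∂₁u₂ - ∂₂u₁`. -/
noncomputable def curl (u : Plane → Plane) (x : Plane) : ℝ :=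
  fderiv ℝ u x (EuclideanSpace.single 0 1) 1 - fderiv ℝ u x (EuclideanSpace.single 1 1) 0

/-- `div u = ∂₁u₁ + ∂₂u₂`. -/
noncomputable def divergence (u : Plane → Plane) (x : Plane) : ℝ :=
  fderiv ℝ u x (EuclideanSpace.single 0 1) 0 + fderiv ℝ u x (EuclideanSpace.single 1 1) 1

/-- A time dependent field `f t x` is `C^∞` on `[0, ∞) × ℝ²`, up to and including `t = 0`. -/
def SmoothField {F : Type*} [NormedAddCommGroup F] [NormedSpace ℝ F] (f : ℝ → Plane → F) : Prop :=
  ContDiffOn ℝ ((⊤ : ℕ∞) : WithTop ℕ∞) (fun p : ℝ × Plane => f p.1 p.2) (Set.Ici 0 ×ˢ Set.univ)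

/-- The norm condition in `f ∈ L^∞_loc([0, ∞); L^Q(ℝ²))`. -/
def LocBddInLp (Q : ENNReal) (f : ℝ → Plane → ℝ) : Prop :=
  ∀ T : ℝ, ∃ C : NNReal, ∀ᵐ t ∂(MeasureTheory.volume.restrict (Set.Icc 0 T)),
    MeasureTheory.eLpNorm (f t) Q MeasureTheory.volume ≤ C

/-- The norm condition in `f ∈ L^1_loc([0, ∞); L^Q(ℝ²))`. -/
def LocIntegrableInLp (Q : ENNReal) (f : ℝ → Plane → ℝ) : Prop :=
  ∀ T : ℝ, ∫⁻ t in Set.Icc 0 T, MeasureTheory.eLpNorm (f t) Q MeasureTheory.volume < ⊤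

/-- `(ω, v)` is a `C^∞` solution of the planar Euler equations in vorticity form with external
force `Z` and initial vorticity `ω₀`, in the class given by the exponents `Q₀` and `Q₁`.
The equation itself shows that `Z` is `C^∞` on `[0, ∞) × ℝ²`. -/
structure IsSmoothEulerSolution (Q₀ Q₁ : ENNReal) (ω₀ : Plane → ℝ) (ω : ℝ → Plane → ℝ)
    (v : ℝ → Plane → Plane) (Z : ℝ → Plane → ℝ) : Prop where
  smooth_vorticity : SmoothField ω
  smooth_velocity : SmoothField v
  /-- `∂ₜω = -(v, ∂ₓ)ω + Z`; the time derivative is one-sided at `t = 0`. -/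
  equation : ∀ t, 0 ≤ t → ∀ x,
    derivWithin (fun s => ω s x) (Set.Ici 0) t = -(fderiv ℝ (ω t) x (v t x)) + Z t x
  curl_eq : ∀ t, 0 ≤ t → ∀ x, curl (v t) x = ω t x
  div_eq : ∀ t, 0 ≤ t → ∀ x, divergence (v t) x = 0
  velocity_eq : ∀ t, 0 ≤ t → ∀ x, v t x = biotSavart (ω t) x
  initial : ω 0 = ω₀
  initial_memLp₀ : MeasureTheory.MemLp ω₀ Q₀ MeasureTheory.volume
  initial_memLp₁ : MeasureTheory.MemLp ω₀ Q₁ MeasureTheory.volume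
  vorticity_bdd₀ : LocBddInLp Q₀ ω
  vorticity_bdd₁ : LocBddInLp Q₁ ω
  force_integrable₀ : LocIntegrableInLp Q₀ Z
  force_integrable₁ : LocIntegrableInLp Q₁ Z

end PlanarEuler

open MeasureTheory Set Metric Filter Topology
open scoped ENNReal NNReal

namespace PlanarEuler

/-! Formally, a divergence-free field carries `ω` without changing `∫ |ω|^q`, so only the force
contributes: `d/dt ∫ |ω|^q = q ∫ |ω|^(q-2) ω Z`, and Hölder turns this into `d/dt ‖ω‖_q ≤ ‖Z‖_q`.
For arbitrary `Q` neither the membership of `ω t` in `L^Q` nor any decay at infinity is available,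
so the computation is localized.

The velocity is bounded by some `C` on `(0, T) × ℝ²` (`exists_norm_velocity_le`); this is where the
exponents `Q₀`, `Q₁` and the Biot-Savart law enter. A cutoff `θ` of a ball shrinking at speed `C`
then satisfies `∂ₜθ + v·∇θ ≤ 0`, so the error made by cutting off has a favourable sign and is
dropped (`deriv_coneCutoff_add_fderiv_le`). With `|s|^q` smoothed to `β(s) = (ε + s²)^(q/2)`, this
gives a differential inequality for `∫ θ β(ω)` (`exists_hasDerivAt_integral_regPow`), which
`rpow_inv_le_add_integral` integrates; then `ε → 0`.

The outcome, `eLpNorm_restrict_ball_le`, controls a ball by the data on a larger ball with constant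
one. Fatou's lemma as the ball grows gives finite `Q`; for `Q = ∞` one first lets `q → ∞` on a fixed
ball. -/

/-! ### The Biot-Savart kernel and a uniform bound on the velocity. -/

theorem norm_perp (x : Plane) : ‖perp x‖ = ‖x‖ := by
  simp [perp, EuclideanSpace.norm_eq, Fin.sum_univ_two, add_comm]

theorem continuous_perp : Continuous perp := by
  unfold perp
  fun_prop

theorem measurable_biotSavartKernel : Measurable biotSavartKernel := by
  unfold biotSavartKernel
  have := continuous_perp.measurable
  fun_prop

theorem norm_biotSavartKernel_le (x : Plane) : ‖biotSavartKernel x‖ ≤ ‖x‖⁻¹ := by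
  rcases eq_or_ne x 0 with rfl | hx
  · simp [biotSavartKernel]
  have hx' : 0 < ‖x‖ := norm_pos_iff.2 hx
  have hpi := Real.pi_gt_three
  rw [biotSavartKernel, norm_smul, norm_perp, norm_inv, Real.norm_of_nonneg (by positivity)]
  have : (2 * Real.pi * ‖x‖ ^ 2)⁻¹ * ‖x‖ = (2 * Real.pi)⁻¹ * ‖x‖⁻¹ := by field_simp
  rw [this]
  exact mul_le_of_le_one_left (by positivity) (inv_le_one_of_one_le₀ (by linarith))

/-- In the plane `|x|^(-p)` is integrable at the origin for `p < 2`. -/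
theorem memLp_biotSavartKernel_near {p : ℝ≥0∞} (hp : p ≠ 0) (hp2 : p < 2) :
    MemLp ((ball 0 1).indicator biotSavartKernel) p volume := by
  have hpt : p ≠ ⊤ := (hp2.trans (by simp)).ne
  have hp0 : 0 < p.toReal := ENNReal.toReal_pos hp hpt
  have hp2' : p.toReal < 2 := by
    simpa using (ENNReal.toReal_lt_toReal hpt (by simp)).2 hp2
  rw [memLp_indicator_iff_restrict measurableSet_ball,
    ← integrable_norm_rpow_iff measurable_biotSavartKernel.aestronglyMeasurable hp hpt]
  refine integrableOn_ball_of_norm_le_rpow (C := 1) (α := p.toReal) (by simp) (by simpa) ?_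
    (measurable_biotSavartKernel.norm.pow_const _).aestronglyMeasurable
  refine .of_forall fun x => ?_
  rw [Real.norm_of_nonneg (by positivity), one_mul, Real.rpow_neg (norm_nonneg _),
    ← Real.inv_rpow (norm_nonneg _)]
  exact Real.rpow_le_rpow (norm_nonneg _) (norm_biotSavartKernel_le x) hp0.le

/-- In the plane `(1 + |x|)^(-p)` is integrable for `p > 2`, and outside the unit ball `|x|⁻¹ ≤ 2 /
(1 + |x|)`. -/
theorem memLp_biotSavartKernel_far {p : ℝ≥0∞} (hp : 2 < p) (hpt : p ≠ ⊤) :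
    MemLp ((ball 0 1)ᶜ.indicator biotSavartKernel) p volume := by
  have hp2 : 2 < p.toReal := by
    simpa using (ENNReal.toReal_lt_toReal (by simp) hpt).2 hp
  have hm : Measurable ((ball (0 : Plane) 1)ᶜ.indicator biotSavartKernel) :=
    measurable_biotSavartKernel.indicator measurableSet_ball.compl
  rw [← integrable_norm_rpow_iff hm.aestronglyMeasurable (by positivity) hpt]
  refine ((integrable_one_add_norm (E := Plane) (μ := volume) (r := p.toReal)
    (by simpa)).const_mul (2 ^ p.toReal)).mono' (hm.norm.pow_const _).aestronglyMeasurable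
    (.of_forall fun x => ?_)
  rw [Real.norm_of_nonneg (by positivity), Real.rpow_neg (by positivity),
    ← Real.inv_rpow (by positivity), ← Real.mul_rpow (by positivity) (by positivity)]
  refine Real.rpow_le_rpow (norm_nonneg _) ?_ (by positivity)
  by_cases hx : x ∈ ball (0 : Plane) 1
  · rw [indicator_of_notMem (by simpa using hx), norm_zero]
    positivity
  · rw [indicator_of_mem hx]
    have h1 : 1 ≤ ‖x‖ := by simpa using hx
    refine (norm_biotSavartKernel_le x).trans ?_
    rw [← div_eq_mul_inv, inv_eq_one_div, div_le_div_iff₀ (by positivity) (by positivity)]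
    linarith

theorem lintegral_enorm_mul_translate_le {p q : ℝ≥0∞} [ENNReal.HolderConjugate p q]
    {f : Plane → ℝ} {k : Plane → Plane} (hf : AEStronglyMeasurable f volume)
    (hk : AEStronglyMeasurable k volume) (x : Plane) :
    ∫⁻ y, ‖f y‖ₑ * ‖k (x - y)‖ₑ ≤ eLpNorm f p volume * eLpNorm k q volume := by
  have hmp := Measure.measurePreserving_sub_left (volume : Measure Plane) x
  have h := eLpNorm_smul_le_mul_eLpNorm (p := p) (q := q) (r := 1) (μ := volume)
    (hk.comp_measurePreserving hmp) hf
  rw [eLpNorm_comp_measurePreserving hk hmp] at h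
  refine le_trans (le_of_eq ?_) h
  simp [eLpNorm_one_eq_lintegral_enorm, enorm_smul]

/-- The kernel lies in no single `L^q`, so it is split at the unit circle and Hölder is applied to
each piece with its own pair of exponents. -/
theorem enorm_biotSavart_le {p₀ q₀ p₁ q₁ : ℝ≥0∞} [ENNReal.HolderConjugate p₀ q₀]
    [ENNReal.HolderConjugate p₁ q₁] {f : Plane → ℝ} (hf : AEStronglyMeasurable f volume)
    (x : Plane) :
    ‖biotSavart f x‖ₑ ≤
      eLpNorm f p₁ volume * eLpNorm ((ball 0 1).indicator biotSavartKernel) q₁ volume +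
      eLpNorm f p₀ volume * eLpNorm ((ball 0 1)ᶜ.indicator biotSavartKernel) q₀ volume := by
  have hn : Measurable ((ball (0 : Plane) 1).indicator biotSavartKernel) :=
    measurable_biotSavartKernel.indicator measurableSet_ball
  have hm : Measurable ((ball (0 : Plane) 1)ᶜ.indicator biotSavartKernel) :=
    measurable_biotSavartKernel.indicator measurableSet_ball.compl
  calc ‖biotSavart f x‖ₑ ≤ ∫⁻ y, ‖f y • biotSavartKernel (x - y)‖ₑ :=
        enorm_integral_le_lintegral_enorm _
    _ ≤ ∫⁻ y, (‖f y‖ₑ * ‖(ball 0 1).indicator biotSavartKernel (x - y)‖ₑ +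
          ‖f y‖ₑ * ‖(ball 0 1)ᶜ.indicator biotSavartKernel (x - y)‖ₑ) := by
        refine lintegral_mono fun y => ?_
        by_cases hy : x - y ∈ ball (0 : Plane) 1
        · rw [indicator_of_mem hy, enorm_smul]
          exact le_self_add
        · rw [indicator_of_mem (s := (ball (0 : Plane) 1)ᶜ) hy, enorm_smul]
          exact le_add_self
    _ = (∫⁻ y, ‖f y‖ₑ * ‖(ball 0 1).indicator biotSavartKernel (x - y)‖ₑ) +
          ∫⁻ y, ‖f y‖ₑ * ‖(ball 0 1)ᶜ.indicator biotSavartKernel (x - y)‖ₑ := by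
        refine lintegral_add_left' (hf.enorm.mul ?_) _
        exact (hn.comp (measurable_const.sub measurable_id)).enorm.aemeasurable
    _ ≤ _ := add_le_add
        (lintegral_enorm_mul_translate_le hf hn.aestronglyMeasurable x)
        (lintegral_enorm_mul_translate_le hf hm.aestronglyMeasurable x)

/-- A bound that holds for almost every time holds for every time by continuity. -/
theorem norm_le_of_ae_norm_le {E : Type*} [NormedAddCommGroup E] {u : ℝ → E} {U : Set ℝ}
    (hU : IsOpen U) (hu : ContinuousOn u U) {C : ℝ}
    (h : ∀ᵐ t ∂volume.restrict U, ‖u t‖ ≤ C) {t : ℝ} (ht : t ∈ U) : ‖u t‖ ≤ C := by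
  -- Writing the bound as the equation `max ‖u t‖ C = C` reduces it to the fact that continuous
  -- functions equal almost everywhere on an open set are equal there.
  have := Measure.eqOn_open_of_ae_eq (μ := volume) (f := fun t => max ‖u t‖ C)
    (g := fun _ => C) (h.mono fun t ht => max_eq_right ht) hU
    (hu.norm.sup continuousOn_const) continuousOn_const ht
  exact max_eq_right_iff.1 this

/-- Since `Q₁ > 2` has conjugate exponent below `2` and `Q₀ < 2` has one above `2`, the near and far
parts of the kernel have finite norms. The vorticity bounds hold for almost every time only;
continuity of `s ↦ v s x` at fixed `x` removes the exceptional times. -/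
theorem exists_norm_velocity_le {Q₀ Q₁ : ℝ≥0∞} (hQ₀ : 1 < Q₀) (hQ₀' : Q₀ < 2) (hQ₁ : 2 < Q₁)
    {ω₀ : Plane → ℝ} {ω : ℝ → Plane → ℝ} {v : ℝ → Plane → Plane} {Z : ℝ → Plane → ℝ}
    (h : IsSmoothEulerSolution Q₀ Q₁ ω₀ ω v Z) (T : ℝ) :
    ∃ C : ℝ, 0 ≤ C ∧ ∀ t ∈ Ioo 0 T, ∀ x, ‖v t x‖ ≤ C := by
  obtain ⟨C₀, hC₀⟩ := h.vorticity_bdd₀ T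
  obtain ⟨C₁, hC₁⟩ := h.vorticity_bdd₁ T
  have hQ₁1 : 1 ≤ Q₁ := le_trans (by norm_num) hQ₁.le
  have : Q₀.HolderConjugate Q₀.conjExponent := .conjExponent hQ₀.le
  have : Q₁.HolderConjugate Q₁.conjExponent := .conjExponent hQ₁1
  have hn := (memLp_biotSavartKernel_near (p := Q₁.conjExponent)
    (by simp [ENNReal.conjExponent]) (by
      rw [ENNReal.conjExponent, ← one_add_one_eq_two]
      refine ENNReal.add_lt_add_left (by simp) (ENNReal.inv_lt_one.2 ?_)
      rw [lt_tsub_iff_right, one_add_one_eq_two]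
      exact hQ₁)).eLpNorm_ne_top
  have hf := (memLp_biotSavartKernel_far (p := Q₀.conjExponent)
    (by
      rw [ENNReal.conjExponent, ← one_add_one_eq_two]
      refine ENNReal.add_lt_add_left (by simp) (ENNReal.one_lt_inv.2 ?_)
      rw [ENNReal.sub_lt_iff_lt_right (by simp) hQ₀.le, one_add_one_eq_two]
      exact hQ₀')
    (by simpa [ENNReal.conjExponent] using (tsub_pos_of_lt hQ₀).ne')).eLpNorm_ne_top
  set A := eLpNorm ((ball 0 1).indicator biotSavartKernel) Q₁.conjExponent volume
  set B := eLpNorm ((ball 0 1)ᶜ.indicator biotSavartKernel) Q₀.conjExponent volume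
  have hfin : (C₁ * A + C₀ * B : ℝ≥0∞) ≠ ⊤ := by finiteness
  refine ⟨(C₁ * A + C₀ * B : ℝ≥0∞).toReal, ENNReal.toReal_nonneg, fun t ht x => ?_⟩
  have hIcc : Ioo 0 T ⊆ Icc 0 T := Ioo_subset_Icc_self
  refine norm_le_of_ae_norm_le (u := fun s => v s x) isOpen_Ioo ?_ ?_ ht
  · refine h.smooth_velocity.continuousOn.comp (f := fun s : ℝ => (s, x)) (by fun_prop) ?_
    exact fun s hs => ⟨hs.1.le, trivial⟩
  · filter_upwards [ae_restrict_of_ae_restrict_of_subset hIcc hC₀,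
      ae_restrict_of_ae_restrict_of_subset hIcc hC₁, ae_restrict_mem measurableSet_Ioo]
      with s h₀ h₁ hs
    have hcont : Continuous (ω s) := by
      rw [← continuousOn_univ]
      refine h.smooth_vorticity.continuousOn.comp (f := fun x : Plane => (s, x)) (by fun_prop) ?_
      exact fun x _ => ⟨hs.1.le, trivial⟩
    rw [h.velocity_eq s hs.1.le x, ← toReal_enorm]
    refine ENNReal.toReal_mono hfin
      ((enorm_biotSavart_le (p₀ := Q₀) (q₀ := Q₀.conjExponent) (p₁ := Q₁)
        (q₁ := Q₁.conjExponent) hcont.aestronglyMeasurable x).trans ?_)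
    gcongr

/-! ### Integrals of compactly supported functions, a differential inequality, Hölder. -/

theorem integrable_of_eq_zero_off_compact {f : Plane → ℝ} {K : Set Plane} (hf : Continuous f)
    (hK : IsCompact K) (h0 : ∀ x ∉ K, f x = 0) : Integrable f volume :=
  hf.integrable_of_hasCompactSupport (.intro hK h0)

/-- Off `K` the function vanishes for all times in the open set `U`, hence so does its time
derivative; a constant multiple of the indicator of `K` therefore dominates near `t`. -/
theorem hasDerivAt_integral_of_compact_support {F F' : ℝ → Plane → ℝ} {U : Set ℝ}
    {K : Set Plane} (hU : IsOpen U) (hK : IsCompact K)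
    (hF : ContinuousOn (Function.uncurry F) (U ×ˢ univ))
    (hF' : ContinuousOn (Function.uncurry F') (U ×ˢ univ))
    (hd : ∀ t ∈ U, ∀ x, HasDerivAt (F · x) (F' t x) t)
    (h0 : ∀ t ∈ U, ∀ x ∉ K, F t x = 0) {t : ℝ} (ht : t ∈ U) :
    Integrable (F' t) volume ∧ HasDerivAt (fun s => ∫ x, F s x) (∫ x, F' t x) t := by
  obtain ⟨δ, hδ, hδU⟩ := nhds_basis_closedBall.mem_iff.1 (hU.mem_nhds ht)
  obtain ⟨M, hM⟩ := ((isCompact_closedBall t δ).prod hK).exists_bound_of_continuousOn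
    (hF'.mono (prod_mono hδU (subset_univ K)))
  have hcont : ∀ {G : ℝ → Plane → ℝ}, ContinuousOn (Function.uncurry G) (U ×ˢ univ) →
      ∀ s ∈ U, Continuous (G s) := fun hG s hs =>
    hG.comp_continuous (.prodMk_right s) fun x => ⟨hs, trivial⟩
  have h0' : ∀ s ∈ U, ∀ x ∉ K, F' s x = 0 := by
    intro s hs x hx
    refine (hd s hs x).unique ((hasDerivAt_const s (0 : ℝ)).congr_of_eventuallyEq ?_)
    filter_upwards [hU.mem_nhds hs] with r hr using h0 r hr x hx
  refine hasDerivAt_integral_of_dominated_loc_of_deriv_le (bound := K.indicator fun _ => M)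
    (closedBall_mem_nhds t hδ) ?_ (integrable_of_eq_zero_off_compact (hcont hF t ht) hK (h0 t ht))
    (hcont hF' t ht).aestronglyMeasurable ?_ ?_ ?_
  · filter_upwards [hU.mem_nhds ht] with s hs using (hcont hF s hs).aestronglyMeasurable
  · refine .of_forall fun x s hs => ?_
    by_cases hx : x ∈ K
    · rw [indicator_of_mem hx]
      exact hM (s, x) ⟨hs, hx⟩
    · rw [indicator_of_notMem hx, h0' s (hδU hs) x hx, norm_zero]
  · exact (integrable_indicator_iff hK.measurableSet).2 (integrableOn_const hK.measure_ne_top)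
  · exact .of_forall fun x s hs => hd s (hδU hs) x

/-- A divergence-free field transports compactly supported functions without changing their
integral. -/
theorem integral_fderiv_apply_eq_zero {u : Plane → Plane} {g : Plane → ℝ} (hu : ContDiff ℝ 1 u)
    (hdiv : ∀ x, divergence u x = 0) (hg : ContDiff ℝ 1 g) (hgc : HasCompactSupport g) :
    ∫ x, fderiv ℝ g x (u x) = 0 := by
  have hg' : Continuous (fderiv ℝ g) := hg.continuous_fderiv (by simp)
  have hu' : Continuous (fderiv ℝ u) := hu.continuous_fderiv (by simp)
  have hud : Differentiable ℝ u := hu.differentiable (by simp)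
  have hui : ∀ i x w, fderiv ℝ (fun y => u y i) x w = fderiv ℝ u x w i := fun i x w => by
    have h := ((EuclideanSpace.proj i : Plane →L[ℝ] ℝ).hasFDerivAt.comp x
      (hud x).hasFDerivAt).fderiv
    exact congr($h w)
  have hgs : ∀ w, HasCompactSupport fun x => fderiv ℝ g x w := fun w => hgc.fderiv_apply ℝ w
  have hint : ∀ i w, Integrable (fun x => u x i * fderiv ℝ g x w) volume := fun i w =>
    Continuous.integrable_of_hasCompactSupport (by fun_prop) ((hgs w).mul_left)
  have hint' : ∀ i w, Integrable (fun x => fderiv ℝ (fun y => u y i) x w * g x) volume :=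
    fun i w => by
      simp_rw [hui]
      exact Continuous.integrable_of_hasCompactSupport (by fun_prop) hgc.mul_left
  have hparts : ∀ i w, ∫ x, u x i * fderiv ℝ g x w =
      -∫ x, fderiv ℝ (fun y => u y i) x w * g x := fun i w =>
    integral_mul_fderiv_eq_neg_fderiv_mul_of_integrable (hint' i w) (hint i w)
      (Continuous.integrable_of_hasCompactSupport (by fun_prop) hgc.mul_left)
      (fun x _ => by fun_prop) (fun x _ => hg.differentiable (by simp) x)
  have hsum : ∀ x, fderiv ℝ g x (u x) =
      u x 0 * fderiv ℝ g x (EuclideanSpace.single 0 1) +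
      u x 1 * fderiv ℝ g x (EuclideanSpace.single 1 1) := fun x => by
    have : u x = u x 0 • EuclideanSpace.single 0 1 + u x 1 • EuclideanSpace.single 1 1 := by
      ext i
      fin_cases i <;> simp
    conv_lhs => rw [this]
    simp only [map_add, map_smul, smul_eq_mul]
  simp_rw [hsum]
  rw [integral_add (hint _ _) (hint _ _), hparts, hparts, ← neg_add,
    ← integral_add (hint' _ _) (hint' _ _)]
  simp_rw [hui, ← add_mul]
  have : ∀ x, (fderiv ℝ u x (EuclideanSpace.single 0 1)).ofLp 0 +
      (fderiv ℝ u x (EuclideanSpace.single 1 1)).ofLp 1 = 0 := hdiv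
  simp [this]

/-- Formally `(f^(1/q))' = q⁻¹ f^(1/q - 1) f' ≤ z`. As `f` may vanish, where this power is singular,
the argument runs with `f + δ` and then `δ → 0`. -/
theorem rpow_inv_le_add_integral {f f' z : ℝ → ℝ} {T q : ℝ} (hT : 0 ≤ T) (hq : 1 ≤ q)
    (hf : ContinuousOn f (Icc 0 T)) (hf0 : ∀ t ∈ Icc 0 T, 0 ≤ f t)
    (hf' : ∀ t ∈ Ioo 0 T, HasDerivAt f (f' t) t) (hz : ContinuousOn z (Icc 0 T))
    (hz0 : ∀ t ∈ Icc 0 T, 0 ≤ z t)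
    (hle : ∀ t ∈ Ioo 0 T, f' t ≤ q * f t ^ (1 - q⁻¹) * z t) :
    f T ^ q⁻¹ ≤ f 0 ^ q⁻¹ + ∫ t in (0)..T, z t := by
  have hq0 : 0 < q := by linarith
  have hq1 : 0 ≤ 1 - q⁻¹ := sub_nonneg.2 (inv_le_one_of_one_le₀ hq)
  have key : ∀ δ > 0, (f T + δ) ^ q⁻¹ - (f 0 + δ) ^ q⁻¹ ≤ ∫ t in (0)..T, z t := by
    intro δ hδ
    refine intervalIntegral.sub_le_integral_of_hasDeriv_right_of_le
      (g := fun t => (f t + δ) ^ q⁻¹) (g' := fun t => f' t * q⁻¹ * (f t + δ) ^ (q⁻¹ - 1)) hT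
      ?_ ?_ hz.integrableOn_Icc ?_
    · exact (hf.add continuousOn_const).rpow_const fun t ht => .inr (by positivity)
    · intro t ht
      have h0 := hf0 t (Ioo_subset_Icc_self ht)
      exact (((hf' t ht).add_const δ).rpow_const (.inl (by positivity))).hasDerivWithinAt
    · intro t ht
      have h0 := hf0 t (Ioo_subset_Icc_self ht)
      have hz' := hz0 t (Ioo_subset_Icc_self ht)
      have hpos : 0 < f t + δ := by positivity
      calc f' t * q⁻¹ * (f t + δ) ^ (q⁻¹ - 1)
          ≤ (q * f t ^ (1 - q⁻¹) * z t) * q⁻¹ * (f t + δ) ^ (q⁻¹ - 1) := by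
            gcongr
            exact hle t ht
        _ ≤ (q * (f t + δ) ^ (1 - q⁻¹) * z t) * q⁻¹ * (f t + δ) ^ (q⁻¹ - 1) := by
            gcongr
            linarith
        _ = (q * q⁻¹) * ((f t + δ) ^ (1 - q⁻¹) * (f t + δ) ^ (q⁻¹ - 1)) * z t := by ring
        _ = z t := by
            rw [← Real.rpow_add hpos, mul_inv_cancel₀ hq0.ne']
            simp
  have hlim : ∀ a : ℝ, Tendsto (fun δ : ℝ => (a + δ) ^ q⁻¹) (𝓝[>] 0) (𝓝 (a ^ q⁻¹)) := by
    intro a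
    have : Continuous fun δ : ℝ => (a + δ) ^ q⁻¹ :=
      (continuous_const.add continuous_id).rpow_const fun _ => .inr (by positivity)
    simpa using (this.tendsto 0).mono_left nhdsWithin_le_nhds
  have := le_of_tendsto ((hlim (f T)).sub (hlim (f 0)))
    (eventually_nhdsWithin_of_forall fun δ hδ => key δ hδ)
  linarith

/-- Hölder's inequality with exponents adding up to one. -/
theorem integral_rpow_mul_rpow_le {f g : Plane → ℝ} (hf : Integrable f volume)
    (hg : Integrable g volume) (hf0 : ∀ x, 0 ≤ f x) (hg0 : ∀ x, 0 ≤ g x) {a b : ℝ} (ha : 0 ≤ a)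
    (hb : 0 ≤ b) (hab : a + b = 1) :
    ∫ x, f x ^ a * g x ^ b ≤ (∫ x, f x) ^ a * (∫ x, g x) ^ b := by
  have hp : ∀ x, 0 ≤ f x ^ a * g x ^ b := fun x =>
    mul_nonneg (Real.rpow_nonneg (hf0 x) a) (Real.rpow_nonneg (hg0 x) b)
  have hIf := integral_nonneg (μ := volume) (f := f) hf0
  have hIg := integral_nonneg (μ := volume) (f := g) hg0
  rw [integral_eq_lintegral_of_nonneg_ae (.of_forall hp)
    ((hf.aemeasurable.pow_const a).mul (hg.aemeasurable.pow_const b)).aestronglyMeasurable]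
  refine ENNReal.toReal_le_of_le_ofReal (by positivity) ?_
  rw [ENNReal.ofReal_mul (by positivity), ← ENNReal.ofReal_rpow_of_nonneg hIf ha,
    ← ENNReal.ofReal_rpow_of_nonneg hIg hb, ofReal_integral_eq_lintegral_ofReal hf (.of_forall hf0),
    ofReal_integral_eq_lintegral_ofReal hg (.of_forall hg0)]
  refine le_trans (le_of_eq (lintegral_congr fun x => ?_)) (ENNReal.lintegral_mul_norm_pow_le
    hf.aemeasurable.ennreal_ofReal hg.aemeasurable.ennreal_ofReal ha hb hab)
  rw [ENNReal.ofReal_mul (Real.rpow_nonneg (hf0 x) a), ENNReal.ofReal_rpow_of_nonneg (hf0 x) ha,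
    ENNReal.ofReal_rpow_of_nonneg (hg0 x) hb]

/-! ### Regularity of the fields up to the initial time. -/

section SmoothField

variable {F : Type*} [NormedAddCommGroup F] [NormedSpace ℝ F] {f : ℝ → Plane → F}

theorem uniqueDiffOn_Ici_prod_univ : UniqueDiffOn ℝ (Ici (0 : ℝ) ×ˢ (univ : Set Plane)) :=
  (uniqueDiffOn_Ici 0).prod uniqueDiffOn_univ

theorem SmoothField.continuousOn_uncurry (hf : SmoothField f) :
    ContinuousOn (Function.uncurry f) (Ici 0 ×ˢ univ) :=
  ContDiffOn.continuousOn hf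

theorem SmoothField.contDiff (hf : SmoothField f) {t : ℝ} (ht : 0 ≤ t) : ContDiff ℝ 1 (f t) := by
  rw [← contDiffOn_univ]
  exact (ContDiffOn.of_le hf (mod_cast le_top)).comp (f := fun x : Plane => (t, x))
    (contDiff_prodMk_right t).contDiffOn fun x _ => ⟨ht, trivial⟩

theorem SmoothField.hasFDerivWithinAt (hf : SmoothField f) {t : ℝ} (ht : 0 ≤ t) (x : Plane) :
    HasFDerivWithinAt (Function.uncurry f)
      (fderivWithin ℝ (Function.uncurry f) (Ici 0 ×ˢ univ) (t, x)) (Ici 0 ×ˢ univ) (t, x) :=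
  (ContDiffOn.differentiableOn hf (by simp) (t, x) ⟨ht, trivial⟩).hasFDerivWithinAt

theorem SmoothField.hasDerivWithinAt (hf : SmoothField f) {t : ℝ} (ht : 0 ≤ t) (x : Plane) :
    HasDerivWithinAt (fun s => f s x)
      (fderivWithin ℝ (Function.uncurry f) (Ici 0 ×ˢ univ) (t, x) (1, 0)) (Ici 0) t :=
  (hf.hasFDerivWithinAt ht x).comp_hasDerivWithinAt t (f := fun s => (s, x))
    ((hasDerivWithinAt_id t _).prodMk (hasDerivWithinAt_const t _ x)) fun _ hs => ⟨hs, trivial⟩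

theorem SmoothField.fderiv_apply (hf : SmoothField f) {t : ℝ} (ht : 0 ≤ t) (x w : Plane) :
    fderiv ℝ (f t) x w =
      fderivWithin ℝ (Function.uncurry f) (Ici 0 ×ˢ univ) (t, x) (0, w) := by
  have h : HasFDerivWithinAt (f t) ((fderivWithin ℝ (Function.uncurry f) (Ici 0 ×ˢ univ)
      (t, x)).comp (ContinuousLinearMap.inr ℝ ℝ Plane)) univ x :=
    (hf.hasFDerivWithinAt ht x).comp x (f := fun y : Plane => (t, y))
      (hasFDerivAt_prodMk_right t x).hasFDerivWithinAt fun y _ => ⟨ht, trivial⟩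
  rw [(hasFDerivWithinAt_univ.1 h).fderiv]
  rfl

theorem SmoothField.continuousOn_fderivWithin_apply (hf : SmoothField f)
    {w : ℝ × Plane → ℝ × Plane} (hw : ContinuousOn w (Ici 0 ×ˢ univ)) :
    ContinuousOn (fun p => fderivWithin ℝ (Function.uncurry f) (Ici 0 ×ˢ univ) p (w p))
      (Ici 0 ×ˢ univ) :=
  (ContDiffOn.continuousOn_fderivWithin hf uniqueDiffOn_Ici_prod_univ (by simp)).clm_apply hw

end SmoothField

section Solution

variable {Q₀ Q₁ : ℝ≥0∞} {ω₀ : Plane → ℝ} {ω : ℝ → Plane → ℝ} {v : ℝ → Plane → Plane}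
  {Z : ℝ → Plane → ℝ}

theorem IsSmoothEulerSolution.continuousOn_transport
    (h : IsSmoothEulerSolution Q₀ Q₁ ω₀ ω v Z) :
    ContinuousOn (fun p : ℝ × Plane => fderiv ℝ (ω p.1) p.2 (v p.1 p.2)) (Ici 0 ×ˢ univ) := by
  refine (h.smooth_vorticity.continuousOn_fderivWithin_apply (w := fun p => (0, v p.1 p.2))
    (continuousOn_const.prodMk h.smooth_velocity.continuousOn_uncurry)).congr fun p hp => ?_
  exact h.smooth_vorticity.fderiv_apply hp.1 _ _

/-- No regularity of `Z` is assumed: the equation expresses it through derivatives of `ω` and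
through `v`. -/
theorem IsSmoothEulerSolution.continuousOn_force (h : IsSmoothEulerSolution Q₀ Q₁ ω₀ ω v Z) :
    ContinuousOn (Function.uncurry Z) (Ici 0 ×ˢ univ) := by
  refine ((h.smooth_vorticity.continuousOn_fderivWithin_apply (w := fun _ => (1, 0))
    continuousOn_const).add h.continuousOn_transport).congr fun p hp => ?_
  have h1 := h.equation p.1 hp.1 p.2
  rw [(h.smooth_vorticity.hasDerivWithinAt hp.1 p.2).derivWithin
    (uniqueDiffOn_Ici 0 p.1 hp.1)] at h1
  simp only [Function.uncurry, Pi.add_apply]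
  linarith

theorem IsSmoothEulerSolution.hasDerivAt_vorticity (h : IsSmoothEulerSolution Q₀ Q₁ ω₀ ω v Z)
    {t : ℝ} (ht : 0 < t) (x : Plane) :
    HasDerivAt (fun s => ω s x) (-(fderiv ℝ (ω t) x (v t x)) + Z t x) t := by
  rw [← h.equation t ht.le x]
  have h1 := h.smooth_vorticity.hasDerivWithinAt ht.le x
  rw [h1.derivWithin (uniqueDiffOn_Ici 0 t ht.le)]
  exact h1.hasDerivAt (Ici_mem_nhds ht)

end Solution

/-! ### The shrinking cutoff. -/

/-- A smooth cutoff of the ball of radius about `R - C * t`, which shrinks at speed `C`. -/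
noncomputable def coneCutoff (C R t : ℝ) (x : Plane) : ℝ :=
  Real.smoothTransition (R - C * t - √(1 + ‖x‖ ^ 2))

section coneCutoff

variable {C R : ℝ}

theorem coneCutoff_nonneg (t : ℝ) (x : Plane) : 0 ≤ coneCutoff C R t x :=
  Real.smoothTransition.nonneg _

theorem coneCutoff_le_one (t : ℝ) (x : Plane) : coneCutoff C R t x ≤ 1 :=
  Real.smoothTransition.le_one _

theorem coneCutoff_eq_zero (hC : 0 ≤ C) {t : ℝ} (ht : 0 ≤ t) {x : Plane}
    (hx : x ∉ closedBall (0 : Plane) R) : coneCutoff C R t x = 0 := by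
  refine Real.smoothTransition.zero_of_nonpos ?_
  have h1 : R < ‖x‖ := by simpa using hx
  have h2 : ‖x‖ ≤ √(1 + ‖x‖ ^ 2) := Real.le_sqrt_of_sq_le (by linarith)
  have := mul_nonneg hC ht
  linarith

/-- Of the margin `2`, one unit pays for `√(1 + ‖x‖²) ≤ 1 + r` and the other for the argument at
which the smooth transition reaches one. -/
theorem coneCutoff_eq_one {t r : ℝ} (hr : 0 ≤ r) (hR : r + 2 + C * t ≤ R) {x : Plane}
    (hx : x ∈ ball (0 : Plane) r) : coneCutoff C R t x = 1 := by
  refine Real.smoothTransition.one_of_one_le ?_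
  have h1 : ‖x‖ < r := by simpa using hx
  have h2 : √(1 + ‖x‖ ^ 2) ≤ 1 + r := by
    rw [Real.sqrt_le_left (by positivity)]
    nlinarith [norm_nonneg x]
  linarith

theorem contDiff_coneCutoff (t : ℝ) : ContDiff ℝ 1 (coneCutoff C R t) :=
  Real.smoothTransition.contDiff.comp (contDiff_const.sub
    ((contDiff_const.add (contDiff_norm_sq ℝ)).sqrt fun x => by positivity))

theorem continuous_coneCutoff :
    Continuous fun p : ℝ × Plane => coneCutoff C R p.1 p.2 :=
  Real.smoothTransition.continuous.comp (by fun_prop)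

theorem hasDerivAt_smoothTransition (y : ℝ) :
    HasDerivAt Real.smoothTransition (deriv Real.smoothTransition y) y :=
  (Real.smoothTransition.contDiff.differentiable (n := 1) (by simp) y).hasDerivAt

theorem hasDerivAt_coneCutoff (t : ℝ) (x : Plane) :
    HasDerivAt (fun s => coneCutoff C R s x)
      (-(C * deriv Real.smoothTransition (R - C * t - √(1 + ‖x‖ ^ 2)))) t := by
  have h : HasDerivAt (fun s => R - C * s - √(1 + ‖x‖ ^ 2)) (-C) t := by
    simpa using (((hasDerivAt_id t).const_mul C).const_sub R).sub_const (√(1 + ‖x‖ ^ 2))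
  exact ((hasDerivAt_smoothTransition _).comp t h).congr_deriv (by ring)

theorem fderiv_coneCutoff_apply (t : ℝ) (x w : Plane) :
    fderiv ℝ (coneCutoff C R t) x w =
      -(deriv Real.smoothTransition (R - C * t - √(1 + ‖x‖ ^ 2)) *
        (inner ℝ x w / √(1 + ‖x‖ ^ 2))) := by
  have h1 : HasFDerivAt (fun y : Plane => 1 + ‖y‖ ^ 2) (2 • innerSL ℝ x) x :=
    (hasStrictFDerivAt_norm_sq x).hasFDerivAt.const_add 1
  have h2 := (h1.sqrt (by positivity)).const_sub (R - C * t)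
  have h3 : HasFDerivAt (coneCutoff C R t) _ x :=
    (hasDerivAt_smoothTransition _).comp_hasFDerivAt x h2
  rw [h3.fderiv]
  simp only [smul_neg, neg_apply, smul_apply,
    innerSL_apply_apply, smul_eq_mul, nsmul_eq_mul]
  field_simp
  simp

/-- The cutoff decreases along every field of speed at most `C`. -/
theorem deriv_coneCutoff_add_fderiv_le (t : ℝ) (x : Plane) {w : Plane} (hw : ‖w‖ ≤ C) :
    -(C * deriv Real.smoothTransition (R - C * t - √(1 + ‖x‖ ^ 2))) +
      fderiv ℝ (coneCutoff C R t) x w ≤ 0 := by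
  have hs : 0 ≤ deriv Real.smoothTransition (R - C * t - √(1 + ‖x‖ ^ 2)) :=
    Real.smoothTransition.monotone.deriv_nonneg
  have hr : 0 < √(1 + ‖x‖ ^ 2) := by positivity
  have h2 : ‖x‖ ≤ √(1 + ‖x‖ ^ 2) := Real.le_sqrt_of_sq_le (by linarith)
  have h3 : -C ≤ inner ℝ x w / √(1 + ‖x‖ ^ 2) := by
    rw [le_div_iff₀ hr]
    have h4 := neg_le_of_abs_le (abs_real_inner_le_norm x w)
    have h5 : ‖x‖ * ‖w‖ ≤ √(1 + ‖x‖ ^ 2) * C := by gcongr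
    linarith
  rw [fderiv_coneCutoff_apply]
  nlinarith

end coneCutoff

/-! ### Regularized powers. -/

/-- For `ε > 0`, a smooth approximation of `|s| ^ q`. -/
noncomputable def regPow (q ε s : ℝ) : ℝ := (ε + s ^ 2) ^ (q / 2)

section regPow

variable {q ε : ℝ}

theorem regPow_nonneg (hε : 0 ≤ ε) (s : ℝ) : 0 ≤ regPow q ε s := by
  unfold regPow
  positivity

theorem regPow_zero (q s : ℝ) : regPow q 0 s = |s| ^ q := by
  rw [regPow, zero_add, ← sq_abs, ← Real.rpow_natCast, ← Real.rpow_mul (abs_nonneg s)]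
  congr 1
  push_cast
  ring

theorem continuous_regPow (hq : 0 ≤ q) : Continuous fun p : ℝ × ℝ => regPow q p.1 p.2 :=
  Continuous.rpow_const (by fun_prop) fun _ => .inr (by positivity)

theorem contDiff_regPow (hε : 0 < ε) : ContDiff ℝ 1 (regPow q ε) :=
  (contDiff_const.add (contDiff_id.pow 2)).rpow_const_of_ne
    fun s => (add_pos_of_pos_of_nonneg hε (sq_nonneg s)).ne'

/-- The derivative is `q s (ε + s²)^(q/2 - 1)`. Bounding `|s|` by `(ε + s²)^(1/2)` leaves the
exponent `(q - 1)/2 = (q/2)(1 - 1/q)`, the one that Hölder needs. -/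
theorem abs_deriv_regPow_le (hq : 1 ≤ q) (hε : 0 < ε) (s : ℝ) :
    |deriv (regPow q ε) s| ≤ q * regPow q ε s ^ (1 - q⁻¹) := by
  have hpos : 0 < ε + s ^ 2 := by positivity
  have hd : HasDerivAt (regPow q ε) ((2 * s) * (q / 2) * (ε + s ^ 2) ^ (q / 2 - 1)) s := by
    have h1 : HasDerivAt (fun s : ℝ => ε + s ^ 2) (2 * s) s := by
      simpa using (hasDerivAt_pow 2 s).const_add ε
    exact h1.rpow_const (.inl hpos.ne')
  have hs : |s| ≤ (ε + s ^ 2) ^ (1 / 2 : ℝ) := by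
    rw [← Real.sqrt_eq_rpow]
    exact Real.abs_le_sqrt (by linarith)
  have hq0 : 0 < q := by linarith
  calc |deriv (regPow q ε) s| = q * (|s| * (ε + s ^ 2) ^ (q / 2 - 1)) := by
        rw [hd.deriv, abs_mul, abs_mul, abs_mul, abs_two, abs_of_pos (by positivity : 0 < q / 2),
          abs_of_pos (Real.rpow_pos_of_pos hpos _)]
        ring
    _ ≤ q * ((ε + s ^ 2) ^ (1 / 2 : ℝ) * (ε + s ^ 2) ^ (q / 2 - 1)) := by gcongr
    _ = q * regPow q ε s ^ (1 - q⁻¹) := by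
        rw [← Real.rpow_add hpos, regPow, ← Real.rpow_mul hpos.le]
        congr 2
        field_simp
        ring

end regPow

/-! ### The localized `L^q` estimate for finite `q`. -/

variable {Q₀ Q₁ : ℝ≥0∞} {ω₀ : Plane → ℝ} {ω : ℝ → Plane → ℝ} {v : ℝ → Plane → Plane}
  {Z : ℝ → Plane → ℝ} {T C R q ε : ℝ}

theorem continuousOn_coneCutoff_mul {g : ℝ × Plane → ℝ} {s : Set (ℝ × Plane)}
    (hg : ContinuousOn g s) : ContinuousOn (fun p => coneCutoff C R p.1 p.2 * g p) s :=
  continuous_coneCutoff.continuousOn.mul hg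

theorem continuous_of_continuousOn_slab {g : ℝ → Plane → ℝ} {U : Set ℝ}
    (hg : ContinuousOn (Function.uncurry g) (U ×ˢ univ)) {t : ℝ} (ht : t ∈ U) :
    Continuous (g t) :=
  hg.comp_continuous (.prodMk_right t) fun _ => ⟨ht, trivial⟩

/-- The cutoff is distributed as `θ = θ^(1 - 1/q) θ^(1/q)` over the two Hölder factors, which also
covers `q = 1`. -/
theorem integral_coneCutoff_mul_force_le (hC : 0 ≤ C) {t : ℝ} (ht : 0 ≤ t) (hq : 1 ≤ q)
    (hε : 0 < ε) {a z : Plane → ℝ} (ha : Continuous a) (hz : Continuous z) :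
    ∫ x, coneCutoff C R t x * (deriv (regPow q ε) (a x) * z x) ≤
      q * (∫ x, coneCutoff C R t x * regPow q ε (a x)) ^ (1 - q⁻¹) *
        (∫ x, coneCutoff C R t x * |z x| ^ q) ^ q⁻¹ := by
  have hq0 : 0 < q := by linarith
  have hq1 : 0 ≤ 1 - q⁻¹ := sub_nonneg.2 (inv_le_one_of_one_le₀ hq)
  have hθ : Continuous (coneCutoff C R t) := (contDiff_coneCutoff t).continuous
  have hβ := (contDiff_regPow (q := q) hε).continuous
  have hβ' := (contDiff_regPow (q := q) hε).continuous_deriv (by simp)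
  have hint : ∀ {g : Plane → ℝ}, Continuous g →
      Integrable (fun x => coneCutoff C R t x * g x) volume := fun hg =>
    integrable_of_eq_zero_off_compact (hθ.mul hg) (isCompact_closedBall 0 R) fun x hx => by
      rw [coneCutoff_eq_zero hC ht hx, zero_mul]
  have hzq : Continuous fun x => |z x| ^ q := hz.abs.rpow_const fun _ => .inr hq0.le
  have hβq : Continuous fun x => regPow q ε (a x) ^ (1 - q⁻¹) :=
    (hβ.comp ha).rpow_const fun _ => .inr hq1
  calc ∫ x, coneCutoff C R t x * (deriv (regPow q ε) (a x) * z x)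
      ≤ ∫ x, q * (coneCutoff C R t x * (regPow q ε (a x) ^ (1 - q⁻¹) * |z x|)) := by
        refine integral_mono (hint ((hβ'.comp ha).mul hz))
          ((hint (hβq.mul hz.abs)).const_mul q) fun x => ?_
        have h1 := mul_le_mul_of_nonneg_right (abs_deriv_regPow_le hq hε (a x)) (abs_nonneg (z x))
        rw [← abs_mul] at h1
        calc _ ≤ coneCutoff C R t x * (q * regPow q ε (a x) ^ (1 - q⁻¹) * |z x|) :=
              mul_le_mul_of_nonneg_left ((le_abs_self _).trans h1) (coneCutoff_nonneg t x)
          _ = _ := by ring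
    _ = q * ∫ x, (coneCutoff C R t x * regPow q ε (a x)) ^ (1 - q⁻¹) *
          (coneCutoff C R t x * |z x| ^ q) ^ q⁻¹ := by
        rw [integral_const_mul]
        congr 2 with x
        have h0 : 0 ≤ coneCutoff C R t x := coneCutoff_nonneg t x
        rw [Real.mul_rpow h0 (regPow_nonneg hε.le _), Real.mul_rpow h0 (by positivity),
          Real.rpow_rpow_inv (abs_nonneg _) hq0.ne', mul_mul_mul_comm,
          ← Real.rpow_add_of_nonneg h0 hq1 (by positivity)]
        simp
    _ ≤ q * ((∫ x, coneCutoff C R t x * regPow q ε (a x)) ^ (1 - q⁻¹) *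
          (∫ x, coneCutoff C R t x * |z x| ^ q) ^ q⁻¹) := by
        gcongr
        refine integral_rpow_mul_rpow_le (hint (hβ.comp ha)) (hint hzq) (fun x => ?_)
          (fun x => ?_) hq1 (by positivity) (by ring)
        · exact mul_nonneg (coneCutoff_nonneg t x) (regPow_nonneg hε.le _)
        · exact mul_nonneg (coneCutoff_nonneg t x) (by positivity)
    _ = _ := by ring

/-- With `G = θ β(ω)`, one has `∂ₜG + v·∇G = β(ω)(∂ₜθ + v·∇θ) + θ β'(ω) Z`. The first summand on the
right is nonpositive, and `v·∇G` integrates to zero because `v` is divergence-free. -/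
theorem IsSmoothEulerSolution.exists_hasDerivAt_integral_regPow
    (h : IsSmoothEulerSolution Q₀ Q₁ ω₀ ω v Z) (hC : 0 ≤ C)
    (hv : ∀ t ∈ Ioo 0 T, ∀ x, ‖v t x‖ ≤ C) (hq : 1 ≤ q) (hε : 0 < ε) {t : ℝ}
    (ht : t ∈ Ioo 0 T) :
    ∃ d, HasDerivAt (fun s => ∫ x, coneCutoff C R s x * regPow q ε (ω s x)) d t ∧
      d ≤ q * (∫ x, coneCutoff C R t x * regPow q ε (ω t x)) ^ (1 - q⁻¹) *
        (∫ x, coneCutoff C R t x * |Z t x| ^ q) ^ q⁻¹ := by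
  have hsub : Ioo 0 T ×ˢ (univ : Set Plane) ⊆ Ici 0 ×ˢ univ :=
    prod_mono (fun s hs => hs.1.le) subset_rfl
  have hω := h.smooth_vorticity.continuousOn_uncurry.mono hsub
  have hZ := h.continuousOn_force.mono hsub
  have htr := h.continuousOn_transport.mono hsub
  have hβ : Continuous (regPow q ε) := (contDiff_regPow hε).continuous
  have hβ' : Continuous (deriv (regPow q ε)) := (contDiff_regPow hε).continuous_deriv (by simp)
  have hσ' : Continuous (deriv Real.smoothTransition) :=
    Real.smoothTransition.contDiff.continuous_deriv (n := 1) (by simp)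
  let S : ℝ → Plane → ℝ := fun s x =>
    deriv Real.smoothTransition (R - C * s - √(1 + ‖x‖ ^ 2))
  have hS : Continuous (Function.uncurry S) :=
    hσ'.comp (f := fun p : ℝ × Plane => R - C * p.1 - √(1 + ‖p.2‖ ^ 2)) (by fun_prop)
  have hβω : ContinuousOn (fun p : ℝ × Plane => regPow q ε (ω p.1 p.2)) (Ioo 0 T ×ˢ univ) :=
    hβ.comp_continuousOn hω
  have hβ'ω : ContinuousOn (fun p : ℝ × Plane => deriv (regPow q ε) (ω p.1 p.2))
      (Ioo 0 T ×ˢ univ) := hβ'.comp_continuousOn hω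
  have hωd : ∀ x, DifferentiableAt ℝ (ω t) x := fun x =>
    (h.smooth_vorticity.contDiff ht.1.le).differentiable (by simp) x
  have hβd : ∀ s, HasDerivAt (regPow q ε) (deriv (regPow q ε) s) s := fun s =>
    ((contDiff_regPow hε).differentiable (by simp) s).hasDerivAt
  let G : Plane → ℝ := fun x => coneCutoff C R t x * regPow q ε (ω t x)
  have hGc : ContDiff ℝ 1 G := (contDiff_coneCutoff t).mul
    ((contDiff_regPow hε).comp (h.smooth_vorticity.contDiff ht.1.le))
  have hGs : HasCompactSupport G := .intro (isCompact_closedBall 0 R) fun x hx => by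
    simp only [G]
    rw [coneCutoff_eq_zero hC ht.1.le hx, zero_mul]
  have hvt := h.smooth_velocity.contDiff ht.1.le
  have hG0 : ∫ x, fderiv ℝ G x (v t x) = 0 :=
    integral_fderiv_apply_eq_zero hvt (h.div_eq t ht.1.le) hGc hGs
  have hGd : ∀ x w, fderiv ℝ G x w = coneCutoff C R t x *
      (deriv (regPow q ε) (ω t x) * fderiv ℝ (ω t) x w) +
      regPow q ε (ω t x) * fderiv ℝ (coneCutoff C R t) x w := fun x w => by
    have h1 := ((contDiff_coneCutoff (C := C) (R := R) t).differentiable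
      (by simp) x).hasFDerivAt
    have h2 := (hβd (ω t x)).comp_hasFDerivAt x (hωd x).hasFDerivAt
    have h3 : HasFDerivAt G _ x := h1.mul h2
    rw [h3.fderiv]
    simp
  obtain ⟨hint, hderiv⟩ := hasDerivAt_integral_of_compact_support
    (F := fun s x => coneCutoff C R s x * regPow q ε (ω s x))
    (F' := fun s x => -(C * S s x) * regPow q ε (ω s x) +
      coneCutoff C R s x * (deriv (regPow q ε) (ω s x) *
        (-(fderiv ℝ (ω s) x (v s x)) + Z s x)))
    isOpen_Ioo (isCompact_closedBall 0 R) (continuousOn_coneCutoff_mul hβω)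
    (((continuous_const.mul hS).neg.continuousOn.mul hβω).add
      (continuousOn_coneCutoff_mul (hβ'ω.mul (htr.neg.add hZ))))
    (fun s hs x => (hasDerivAt_coneCutoff s x).mul (HasDerivAt.comp (h := fun r => ω r x) s
      (hβd (ω s x)) (h.hasDerivAt_vorticity hs.1 x)))
    (fun s hs x hx => by rw [coneCutoff_eq_zero hC hs.1.le hx, zero_mul]) ht
  refine ⟨_, hderiv, ?_⟩
  have hi1 : Integrable (fun x => coneCutoff C R t x * (deriv (regPow q ε) (ω t x) * Z t x))
      volume := by
    refine integrable_of_eq_zero_off_compact ?_ (isCompact_closedBall 0 R) fun x hx => by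
      rw [coneCutoff_eq_zero hC ht.1.le hx, zero_mul]
    exact (contDiff_coneCutoff t).continuous.mul
      ((hβ'.comp (h.smooth_vorticity.contDiff ht.1.le).continuous).mul
        (continuous_of_continuousOn_slab hZ ht))
  have hi2 : Integrable (fun x => fderiv ℝ G x (v t x)) volume := by
    refine Continuous.integrable_of_hasCompactSupport
      ((hGc.continuous_fderiv (by simp)).clm_apply hvt.continuous) ?_
    exact (hGs.fderiv ℝ).mono fun x hx => by
      contrapose! hx
      simp [Function.notMem_support.1 hx]
  -- `v·∇G` is subtracted before integrating, so that the transport terms cancel pointwise.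
  calc _ ≤ ∫ x, (coneCutoff C R t x * (deriv (regPow q ε) (ω t x) * Z t x) -
        fderiv ℝ G x (v t x)) := by
        refine integral_mono hint (hi1.sub hi2) fun x => ?_
        have hx := mul_le_mul_of_nonneg_right
          (deriv_coneCutoff_add_fderiv_le (R := R) t x (hv t ht x))
          (regPow_nonneg (q := q) hε.le (ω t x))
        simp only [S, hGd]
        linarith
    _ = ∫ x, coneCutoff C R t x * (deriv (regPow q ε) (ω t x) * Z t x) := by
        rw [integral_sub hi1 hi2, hG0, sub_zero]
    _ ≤ _ := integral_coneCutoff_mul_force_le hC ht.1.le hq hε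
        (h.smooth_vorticity.contDiff ht.1.le).continuous (continuous_of_continuousOn_slab hZ ht)

theorem continuousOn_integral_coneCutoff_mul (hC : 0 ≤ C) {g : ℝ → Plane → ℝ}
    (hg : ContinuousOn (Function.uncurry g) (Icc 0 T ×ˢ univ)) :
    ContinuousOn (fun t => ∫ x, coneCutoff C R t x * g t x) (Icc 0 T) :=
  continuousOn_integral_of_compact_support (isCompact_closedBall (0 : Plane) R)
    (continuousOn_coneCutoff_mul hg) fun t x ht hx => by
      rw [coneCutoff_eq_zero hC ht.1 hx, zero_mul]

/-- The integrand is jointly continuous in `ε` and `x`, including at `ε = 0`, and supported in a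
fixed ball. -/
theorem tendsto_integral_coneCutoff_mul_regPow (hC : 0 ≤ C) {t : ℝ} (ht : 0 ≤ t) (hq : 0 ≤ q)
    {a : Plane → ℝ} (ha : Continuous a) :
    Tendsto (fun ε => ∫ x, coneCutoff C R t x * regPow q ε (a x)) (𝓝[>] 0)
      (𝓝 (∫ x, coneCutoff C R t x * |a x| ^ q)) := by
  have hc : ContinuousOn (fun ε => ∫ x, coneCutoff C R t x * regPow q ε (a x)) univ :=
    continuousOn_integral_of_compact_support (isCompact_closedBall (0 : Plane) R)
      (((contDiff_coneCutoff t).continuous.comp continuous_snd).mul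
        ((continuous_regPow hq).comp
          (continuous_fst.prodMk (ha.comp continuous_snd)))).continuousOn
      fun ε x _ hx => by rw [coneCutoff_eq_zero hC ht hx, zero_mul]
  have := ((continuousOn_univ.1 hc).tendsto 0).mono_left (nhdsWithin_le_nhds (s := Ioi 0))
  simpa only [regPow_zero] using this

theorem IsSmoothEulerSolution.continuousOn_integral_force
    (h : IsSmoothEulerSolution Q₀ Q₁ ω₀ ω v Z) (hC : 0 ≤ C) (hq : 1 ≤ q) :
    ContinuousOn (fun t => (∫ x, coneCutoff C R t x * |Z t x| ^ q) ^ q⁻¹) (Icc 0 T) := by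
  refine (continuousOn_integral_coneCutoff_mul hC (g := fun t x => |Z t x| ^ q) ?_).rpow_const
    fun _ _ => .inr (by positivity)
  exact ((h.continuousOn_force.mono (prod_mono (fun s hs => hs.1) subset_rfl)).abs).rpow_const
    fun _ _ => .inr (by positivity)

theorem IsSmoothEulerSolution.integral_coneCutoff_rpow_le
    (h : IsSmoothEulerSolution Q₀ Q₁ ω₀ ω v Z) (hT : 0 ≤ T) (hC : 0 ≤ C)
    (hv : ∀ t ∈ Ioo 0 T, ∀ x, ‖v t x‖ ≤ C) (hq : 1 ≤ q) :
    (∫ x, coneCutoff C R T x * |ω T x| ^ q) ^ q⁻¹ ≤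
      (∫ x, coneCutoff C R 0 x * |ω 0 x| ^ q) ^ q⁻¹ +
        ∫ t in (0)..T, (∫ x, coneCutoff C R t x * |Z t x| ^ q) ^ q⁻¹ := by
  have hq0 : 0 ≤ q := by linarith
  have hq' : 0 ≤ q⁻¹ := by positivity
  refine le_of_tendsto_of_tendsto
    ((tendsto_integral_coneCutoff_mul_regPow hC hT hq0
      (h.smooth_vorticity.contDiff hT).continuous).rpow_const (.inr hq'))
    (((tendsto_integral_coneCutoff_mul_regPow hC le_rfl hq0
      (h.smooth_vorticity.contDiff le_rfl).continuous).rpow_const (.inr hq')).add_const _)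
    (eventually_nhdsWithin_of_forall fun ε (hε : 0 < ε) => ?_)
  choose! d hd hdle using fun t ht =>
    h.exists_hasDerivAt_integral_regPow (R := R) (t := t) hC hv hq hε ht
  refine rpow_inv_le_add_integral hT hq (continuousOn_integral_coneCutoff_mul hC ?_)
    (fun t _ => integral_nonneg fun x => mul_nonneg (coneCutoff_nonneg t x)
      (regPow_nonneg hε.le _)) hd
    (h.continuousOn_integral_force hC hq) (fun t _ => ?_) hdle
  · exact (contDiff_regPow hε).continuous.comp_continuousOn
      (h.smooth_vorticity.continuousOn_uncurry.mono (prod_mono (fun s hs => hs.1) subset_rfl))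
  · exact Real.rpow_nonneg (integral_nonneg fun x =>
      mul_nonneg (coneCutoff_nonneg t x) (by positivity)) _

theorem ofReal_integral_coneCutoff_rpow (hC : 0 ≤ C) {t : ℝ} (ht : 0 ≤ t) (hq : 0 ≤ q)
    {a : Plane → ℝ} (ha : Continuous a) :
    ENNReal.ofReal ((∫ x, coneCutoff C R t x * |a x| ^ q) ^ q⁻¹) =
      (∫⁻ x, ENNReal.ofReal (coneCutoff C R t x) * ‖a x‖ₑ ^ q) ^ q⁻¹ := by
  have h0 : ∀ x, 0 ≤ coneCutoff C R t x * |a x| ^ q := fun x =>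
    mul_nonneg (coneCutoff_nonneg t x) (by positivity)
  rw [← ENNReal.ofReal_rpow_of_nonneg (integral_nonneg h0) (by positivity),
    ofReal_integral_eq_lintegral_ofReal _ (.of_forall h0)]
  · congr 1
    refine lintegral_congr fun x => ?_
    rw [ENNReal.ofReal_mul (coneCutoff_nonneg t x),
      ← ENNReal.ofReal_rpow_of_nonneg (abs_nonneg _) hq, Real.enorm_eq_ofReal_abs]
  · exact integrable_of_eq_zero_off_compact ((contDiff_coneCutoff t).continuous.mul
      (ha.abs.rpow_const fun _ => .inr hq)) (isCompact_closedBall 0 R) fun x hx => by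
        rw [coneCutoff_eq_zero hC ht hx, zero_mul]

theorem eLpNorm_restrict_eq (hq : 0 < q) (a : Plane → ℝ) (s : Set Plane) :
    eLpNorm a (ENNReal.ofReal q) (volume.restrict s) = (∫⁻ x in s, ‖a x‖ₑ ^ q) ^ q⁻¹ := by
  rw [eLpNorm_eq_lintegral_rpow_enorm_toReal (by simpa) (by simp), ENNReal.toReal_ofReal hq.le,
    one_div]

theorem ofReal_integral_coneCutoff_rpow_le_eLpNorm (hC : 0 ≤ C) {t : ℝ} (ht : 0 ≤ t)
    (hq : 0 < q) {a : Plane → ℝ} (ha : Continuous a) :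
    ENNReal.ofReal ((∫ x, coneCutoff C R t x * |a x| ^ q) ^ q⁻¹) ≤
      eLpNorm a (ENNReal.ofReal q) (volume.restrict (closedBall 0 R)) := by
  rw [ofReal_integral_coneCutoff_rpow hC ht hq.le ha, eLpNorm_restrict_eq hq,
    ← lintegral_indicator measurableSet_closedBall]
  refine ENNReal.rpow_le_rpow (lintegral_mono fun x => ?_) (by positivity)
  by_cases hx : x ∈ closedBall (0 : Plane) R
  · rw [indicator_of_mem hx]
    exact mul_le_of_le_one_left' (by simpa using coneCutoff_le_one t x)
  · rw [coneCutoff_eq_zero hC ht hx]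
    simp

theorem eLpNorm_le_ofReal_integral_coneCutoff_rpow (hC : 0 ≤ C) {t r : ℝ} (ht : 0 ≤ t)
    (hr : 0 ≤ r) (hR : r + 2 + C * t ≤ R) (hq : 0 < q) {a : Plane → ℝ} (ha : Continuous a) :
    eLpNorm a (ENNReal.ofReal q) (volume.restrict (ball 0 r)) ≤
      ENNReal.ofReal ((∫ x, coneCutoff C R t x * |a x| ^ q) ^ q⁻¹) := by
  rw [ofReal_integral_coneCutoff_rpow hC ht hq.le ha, eLpNorm_restrict_eq hq,
    ← lintegral_indicator measurableSet_ball]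
  refine ENNReal.rpow_le_rpow (lintegral_mono fun x => ?_) (by positivity)
  by_cases hx : x ∈ ball (0 : Plane) r
  · rw [indicator_of_mem hx, coneCutoff_eq_one hr hR hx]
    simp
  · rw [indicator_of_notMem hx]
    exact zero_le

/-- Finite speed of propagation: the vorticity on a ball is controlled by the data on a larger
ball. -/
theorem IsSmoothEulerSolution.eLpNorm_restrict_ball_le
    (h : IsSmoothEulerSolution Q₀ Q₁ ω₀ ω v Z) (hT : 0 ≤ T) (hC : 0 ≤ C)
    (hv : ∀ t ∈ Ioo 0 T, ∀ x, ‖v t x‖ ≤ C) (hq : 1 ≤ q) {r : ℝ} (hr : 0 ≤ r)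
    (hR : r + 2 + C * T ≤ R) :
    eLpNorm (ω T) (ENNReal.ofReal q) (volume.restrict (ball 0 r)) ≤
      eLpNorm ω₀ (ENNReal.ofReal q) (volume.restrict (closedBall 0 R)) +
        ∫⁻ t in Icc 0 T, eLpNorm (Z t) (ENNReal.ofReal q) (volume.restrict (closedBall 0 R)) := by
  have hq0 : 0 < q := by linarith
  have h0 : ∀ t (a : Plane → ℝ), 0 ≤ (∫ x, coneCutoff C R t x * |a x| ^ q) ^ q⁻¹ := fun t a =>
    Real.rpow_nonneg (integral_nonneg fun x =>
      mul_nonneg (coneCutoff_nonneg t x) (by positivity)) _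
  calc _ ≤ ENNReal.ofReal ((∫ x, coneCutoff C R T x * |ω T x| ^ q) ^ q⁻¹) :=
        eLpNorm_le_ofReal_integral_coneCutoff_rpow hC hT hr hR hq0
          (h.smooth_vorticity.contDiff hT).continuous
    _ ≤ ENNReal.ofReal ((∫ x, coneCutoff C R 0 x * |ω 0 x| ^ q) ^ q⁻¹ +
          ∫ t in Icc 0 T, (∫ x, coneCutoff C R t x * |Z t x| ^ q) ^ q⁻¹) := by
        refine ENNReal.ofReal_le_ofReal ((h.integral_coneCutoff_rpow_le hT hC hv hq).trans_eq ?_)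
        rw [intervalIntegral.integral_of_le hT, integral_Icc_eq_integral_Ioc]
    _ = ENNReal.ofReal ((∫ x, coneCutoff C R 0 x * |ω 0 x| ^ q) ^ q⁻¹) +
          ∫⁻ t in Icc 0 T, ENNReal.ofReal ((∫ x, coneCutoff C R t x * |Z t x| ^ q) ^ q⁻¹) := by
        rw [ENNReal.ofReal_add (h0 0 _) (integral_nonneg fun t => h0 t _),
          ofReal_integral_eq_lintegral_ofReal
            (h.continuousOn_integral_force hC hq).integrableOn_Icc (.of_forall fun t => h0 t _)]
    _ ≤ _ := by
        rw [← h.initial]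
        gcongr ?_ + ?_
        · exact ofReal_integral_coneCutoff_rpow_le_eLpNorm hC le_rfl hq0
            (h.smooth_vorticity.contDiff le_rfl).continuous
        · refine setLIntegral_mono' measurableSet_Icc fun t ht => ?_
          exact ofReal_integral_coneCutoff_rpow_le_eLpNorm hC ht.1 hq0
            (continuous_of_continuousOn_slab h.continuousOn_force ht.1)

/-! ### Passage to the whole plane and to `Q = ∞`. -/

/-- Fatou's lemma for the truncations of `a` to balls of integer radius; it needs no prior
membership of `a` in `L^Q`. -/
theorem eLpNorm_le_of_forall_restrict_ball_le {a : Plane → ℝ} (ha : Continuous a) {Q A : ℝ≥0∞}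
    (h : ∀ r : ℝ, 0 ≤ r → eLpNorm a Q (volume.restrict (ball 0 r)) ≤ A) :
    eLpNorm a Q volume ≤ A := by
  refine (Lp.eLpNorm_lim_le_liminf_eLpNorm
    (f := fun n : ℕ => (ball (0 : Plane) n).indicator a)
    (fun n => ha.aestronglyMeasurable.indicator measurableSet_ball) a
    (.of_forall fun x => ?_)).trans ?_
  · obtain ⟨N, hN⟩ := exists_nat_gt ‖x‖
    refine tendsto_const_nhds.congr' ?_
    filter_upwards [eventually_ge_atTop N] with n hn
    rw [indicator_of_mem]
    have : (N : ℝ) ≤ n := mod_cast hn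
    simpa using hN.trans_le this
  · refine liminf_le_of_le (by isBoundedDefault) fun b hb => ?_
    obtain ⟨n, hn⟩ := hb.exists
    rw [eLpNorm_indicator_eq_eLpNorm_restrict measurableSet_ball] at hn
    exact hn.trans (h n (by positivity))

/-- An essential bound from bounds of the `L^q` norms that are uniform as `q → ∞`. -/
theorem eLpNorm_top_le_of_forall_rpow {α : Type*} [MeasurableSpace α] {μ : Measure α}
    {a : α → ℝ} (ha : AEStronglyMeasurable a μ) {V A : ℝ≥0∞}
    (hV : V ≠ ⊤)
    (h : ∀ q : ℝ, 1 ≤ q → eLpNorm a (ENNReal.ofReal q) μ ≤ A * V ^ q⁻¹) :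
    eLpNorm a ⊤ μ ≤ A := by
  rw [eLpNorm_exponent_top, eLpNormEssSup]
  refine le_of_forall_gt_imp_ge_of_dense fun c hc => ?_
  rcases eq_or_ne c ⊤ with rfl | hct
  · exact le_top
  have hc0 : c ≠ 0 := hc.ne_bot
  -- Chebyshev's inequality with exponent `n`; as `A < c`, the right side tends to zero, so the
  -- level set at height `c` is null.
  have hbound : ∀ n : ℕ, 1 ≤ n → μ {x | c ≤ ‖a x‖ₑ} ≤ (A / c) ^ n * V := by
    intro n hn
    have hn0 : n ≠ 0 := by lia
    have h1 := (mul_meas_ge_le_pow_eLpNorm' μ (p := n) (by simpa) (by simp) ha c).trans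
      (ENNReal.rpow_le_rpow (by simpa using h n (mod_cast hn)) (by simp))
    rw [ENNReal.toReal_natCast, ENNReal.rpow_natCast, ENNReal.rpow_natCast, mul_pow,
      ENNReal.rpow_inv_natCast_pow hn0 V] at h1
    rw [div_eq_mul_inv, mul_pow, mul_right_comm, ← ENNReal.inv_pow, ← div_eq_mul_inv,
      ENNReal.le_div_iff_mul_le (.inl (pow_ne_zero n hc0)) (.inl (by finiteness)), mul_comm]
    exact h1
  have hlt : A / c < 1 := (ENNReal.div_lt_iff (.inl hc0) (.inl hct)).2 (by simpa)
  have hlim : Tendsto (fun n : ℕ => (A / c) ^ n * V) atTop (𝓝 0) := by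
    simpa using ENNReal.Tendsto.mul_const (ENNReal.tendsto_pow_atTop_nhds_zero_of_lt_one hlt)
      (.inr hV)
  have hzero : μ {x | c ≤ ‖a x‖ₑ} = 0 := le_antisymm
    (ge_of_tendsto hlim ((eventually_ge_atTop 1).mono hbound)) zero_le
  refine essSup_le_of_ae_le c ?_
  filter_upwards [measure_eq_zero_iff_ae_notMem.1 hzero] with x hx
  exact (not_le.1 hx).le

end PlanarEuler

open PlanarEuler in
theorem theorem9p2 (Q₀ Q₁ : ENNReal) (hQ₀ : 1 < Q₀) (hQ₀' : Q₀ < 2) (hQ₁ : 2 < Q₁) (hQ₁' : Q₁ < ⊤)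
    (ω₀ : PlanarEuler.Plane → ℝ) (ω : ℝ → PlanarEuler.Plane → ℝ)
    (v : ℝ → PlanarEuler.Plane → PlanarEuler.Plane) (Z : ℝ → PlanarEuler.Plane → ℝ)
    (h : PlanarEuler.IsSmoothEulerSolution Q₀ Q₁ ω₀ ω v Z)
    (Q : ENNReal) (hQ : 1 ≤ Q) (t : ℝ) (ht : 0 ≤ t) :
    MeasureTheory.eLpNorm (ω t) Q MeasureTheory.volume ≤
      MeasureTheory.eLpNorm ω₀ Q MeasureTheory.volume +
        ∫⁻ s in Set.Icc 0 t, MeasureTheory.eLpNorm (Z s) Q MeasureTheory.volume := by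
  obtain ⟨C, hC, hv⟩ := exists_norm_velocity_le hQ₀ hQ₀' hQ₁ h t
  have hω := (h.smooth_vorticity.contDiff ht).continuous
  refine eLpNorm_le_of_forall_restrict_ball_le hω fun r hr => ?_
  have hlocal := fun (q : ℝ) (hq : 1 ≤ q) =>
    h.eLpNorm_restrict_ball_le ht hC hv hq hr le_rfl
  rcases eq_or_ne Q ⊤ with rfl | hQt
  -- On the larger ball `‖a‖_q ≤ ‖a‖_∞ V^(1/q)`, with `V` its volume. The same factor appears in the
  -- initial and the force term, so it can be pulled out and disappears as `q → ∞`.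
  · refine eLpNorm_top_le_of_forall_rpow hω.aestronglyMeasurable
      (V := volume (closedBall (0 : Plane) (r + 2 + C * t)))
      measure_closedBall_lt_top.ne fun q hq => ?_
    have hq0 : 0 < q := by linarith
    have hle : ∀ a : Plane → ℝ, Continuous a → eLpNorm a (ENNReal.ofReal q)
        (volume.restrict (closedBall 0 (r + 2 + C * t))) ≤
        eLpNorm a ⊤ volume * volume (closedBall (0 : Plane) (r + 2 + C * t)) ^ q⁻¹ := by
      intro a ha
      refine (eLpNorm_le_eLpNorm_mul_rpow_measure_univ (f := a) (q := ⊤) le_top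
        ha.aestronglyMeasurable).trans ?_
      simp only [Measure.restrict_apply_univ, ENNReal.toReal_ofReal hq0.le, ENNReal.toReal_top,
        one_div, inv_zero, sub_zero]
      gcongr
      exact Measure.restrict_le_self
    refine (hlocal q hq).trans ?_
    rw [add_mul, ← lintegral_mul_const' _ _
      (ENNReal.rpow_ne_top_of_nonneg (by positivity) measure_closedBall_lt_top.ne)]
    gcongr ?_ + ?_
    · rw [← h.initial]
      exact hle _ (h.smooth_vorticity.contDiff le_rfl).continuous
    · exact setLIntegral_mono' measurableSet_Icc fun s hs =>
        hle _ (continuous_of_continuousOn_slab h.continuousOn_force hs.1)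
  · have hq := hlocal Q.toReal (by simpa using ENNReal.toReal_mono hQt hQ)
    rw [ENNReal.ofReal_toReal hQt] at hq
    refine hq.trans ?_
    gcongr <;> exact Measure.restrict_le_self
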